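/- Let $d\ge 1$ and let $\mathcal H$ be a $d$-dimensional complex Hilbert space. A POVM on a finite-dimensional Hilbert space is a finite family of positive semidefinite operators summing to the identity; it is simple if its elements are pairwise linearly independent. For POVMs $\mathscr A=\{A_j\}_j$ and $\mathscr B=\{B_k\}_k$ on $\mathcal H$, $\mathscr A\otimes\mathscr B$ denotes the POVM $\{A_j\otimes B_k\}_{j,k}$ on $\mathcal H^{\otimes 2}$. They are mutually unbiased if $\operatorname{tr}(A_jB_k)=\operatorname{tr}(A_j)\operatorname{tr}(B_k)/d$ for all $j,k$; a POVM is a rank-1 projective measurement if its elements are mutually orthogonal rank-1 projectors. The two-copy estimation fidelity of a POVM $\mathscr M=\{M_j\}_j$ on $\mathcal H^{\otimes 2}$ is the maximal average fidelity $$F(\mathscr M)=\max_{\{\hat\rho_j\}}\sum_j\int d\mu(\psi)\,\operatorname{tr}\bigl(\rho^{\otimes 2}M_j\bigr)\operatorname{tr}(\rho\hat\rho_j),\qquad \rho=|\psi\rangle\langle\psi|,$$ where $\mu$ is the distribution of Haar random pure states on $\mathcal H$ and the maximum is over all families of density operators $\hat\rho_j$ on $\mathcal H$. Suppose $\mathscr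 A$ and $\mathscr B$ are two simple POVMs on $\mathcal H$. Then $\mathscr A$ and $\mathscr B$ are mutually unbiased rank-1 projective measurements if and only if $$F(\mathscr A\otimes\mathscr B)=\frac{2(d+1+\sqrt d)}{(d+1)(d+2)}\quad\text{and}\quad F(\mathscr A\otimes\mathscr A)=F(\mathscr B\otimes\mathscr B)=\frac{2}{d+1}.$$ -/

import Mathlib

open MeasureTheory Matrix
open scoped Kronecker ComplexOrder

noncomputable section

/-! ### Measurements on a finite-dimensional Hilbert space `ℂ^n`

Operators on the Hilbert space with orthonormal basis indexed by `n` are matrices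
`Matrix n n ℂ`; the tensor product of two such spaces is indexed by the product type, and the
tensor product of operators is the Kronecker product. -/

/-- A POVM with outcomes `ι`: positive (semidefinite) operators that sum up to the identity. -/
structure POVM (n : Type*) [Fintype n] [DecidableEq n] (ι : Type*) [Fintype ι] where
  /-- the POVM elements -/
  elem : ι → Matrix n n ℂ
  posSemidef : ∀ j, (elem j).PosSemidef
  sum_elem : ∑ j, elem j = 1

namespace POVM

/-- A POVM is simple if its elements are pairwise linearly independent. -/
def IsSimple {n ι : Type*} [Fintype n] [DecidableEq n] [Fintype ι] (A : POVM n ι) : Prop :=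
  ∀ i j, i ≠ j → LinearIndependent ℂ ![A.elem i, A.elem j]

/-- A rank-1 projective measurement: the elements are mutually orthogonal rank-1 projectors. -/
def IsRankOneProjective {n ι : Type*} [Fintype n] [DecidableEq n] [Fintype ι]
    (A : POVM n ι) : Prop :=
  (∀ j, IsStarProjection (A.elem j) ∧ (A.elem j).rank = 1) ∧
    ∀ i j, i ≠ j → A.elem i * A.elem j = 0

/-- Two POVMs are mutually unbiased if `tr (A_j B_k) = tr A_j * tr B_k / d` for all `j`, `k`,
where `d` is the dimension of the Hilbert space. -/
def IsMutuallyUnbiased {n ι κ : Type*} [Fintype n] [DecidableEq n] [Fintype ι] [Fintype κ]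
    (A : POVM n ι) (B : POVM n κ) : Prop :=
  ∀ j k, (A.elem j * B.elem k).trace =
    (A.elem j).trace * (B.elem k).trace / (Fintype.card n : ℂ)

/-- The product POVM `A ⊗ B = {A_j ⊗ B_k}_{j,k}`. -/
def tensor {m n ι κ : Type*} [Fintype m] [DecidableEq m] [Fintype n] [DecidableEq n]
    [Fintype ι] [Fintype κ] (A : POVM m ι) (B : POVM n κ) : POVM (m × n) (ι × κ) where
  elem p := A.elem p.1 ⊗ₖ B.elem p.2
  posSemidef p := (A.posSemidef p.1).kronecker (B.posSemidef p.2)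
  sum_elem := by
    rw [← one_kronecker_one (α := ℂ), ← A.sum_elem, ← B.sum_elem, Fintype.sum_prod_type]
    ext x y
    simp [Matrix.sum_apply, kroneckerMap_apply, Finset.sum_mul_sum]

end POVM

/-! ### Haar random pure states -/

instance (d : ℕ) : CompactSpace (unitaryGroup (Fin d) ℂ) := by
  have hcont : Continuous fun A : Matrix (Fin d) (Fin d) ℂ => A * star A :=
    continuous_id.matrix_mul continuous_id.matrix_conjTranspose
  have hcl : IsClosed (unitaryGroup (Fin d) ℂ : Set (Matrix (Fin d) (Fin d) ℂ)) := by
    have h : (unitaryGroup (Fin d) ℂ : Set (Matrix (Fin d) (Fin d) ℂ)) =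
        (fun A : Matrix (Fin d) (Fin d) ℂ => A * star A) ⁻¹' {1} := by
      ext A
      exact mem_unitaryGroup_iff
    rw [h]
    exact isClosed_singleton.preimage hcont
  have hK : IsCompact (Set.univ.pi fun _ : Fin d =>
      Set.univ.pi fun _ : Fin d => Metric.closedBall (0 : ℂ) 1) :=
    isCompact_univ_pi fun _ => isCompact_univ_pi fun _ => isCompact_closedBall _ _
  exact isCompact_iff_compactSpace.mp <| hK.of_isClosed_subset hcl fun U hU i _ j _ => by
    simpa using entry_norm_bound_of_unitary hU i j

/-- The unitary group carries its Borel σ-algebra. -/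
instance (d : ℕ) : MeasurableSpace (unitaryGroup (Fin d) ℂ) := borel _

instance (d : ℕ) : BorelSpace (unitaryGroup (Fin d) ℂ) := ⟨rfl⟩

/-- The normalized Haar measure on the unitary group `U(d)`. -/
def haarUnitary (d : ℕ) : Measure (unitaryGroup (Fin d) ℂ) := Measure.haarMeasure ⊤

/-- The pure state `|ψ⟩⟨ψ|` with `|ψ⟩ = U |0⟩`; for a Haar random unitary `U` this is a
Haar random pure state. -/
def pureState {d : ℕ} [NeZero d] (U : unitaryGroup (Fin d) ℂ) : Matrix (Fin d) (Fin d) ℂ :=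
  let ψ : Fin d → ℂ := U.1 *ᵥ Pi.single 0 1
  vecMulVec ψ (star ψ)

/-! ### The estimation fidelity -/

/-- Quantum states: positive semidefinite matrices of trace `1`. -/
def DensityMatrix (n : Type*) [Fintype n] : Type _ :=
  {ρ : Matrix n n ℂ // ρ.PosSemidef ∧ ρ.trace = 1}

/-- The average fidelity `∑_j ∫ dμ(ψ) tr (ρ^{⊗2} M_j) tr (ρ ρ̂_j)`, `ρ = |ψ⟩⟨ψ|`, when a
POVM `M` is performed on two copies of a Haar random pure state `ρ`, and the estimate `ρ̂_j` is
reported on outcome `j`. -/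
def averageFidelity {d : ℕ} [NeZero d] {ι : Type*} [Fintype ι] (M : POVM (Fin d × Fin d) ι)
    (est : ι → DensityMatrix (Fin d)) : ℝ :=
  ∑ j, ∫ U, (((pureState U ⊗ₖ pureState U) * M.elem j).trace).re *
    ((pureState U * (est j).1).trace).re ∂(haarUnitary d)

/-- The two-copy estimation fidelity `F(M)`: the maximal average fidelity over all choices of
the estimators. -/
def estimationFidelity {d : ℕ} [NeZero d] {ι : Type*} [Fintype ι]
    (M : POVM (Fin d × Fin d) ι) : ℝ :=
  ⨆ est : ι → DensityMatrix (Fin d), averageFidelity M est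

/-- `F₂^sep = 2 (d + 1 + √d) / ((d + 1) (d + 2))`. -/
def fidelitySep (d : ℕ) : ℝ :=
  2 * ((d : ℝ) + 1 + √(d : ℝ)) / (((d : ℝ) + 1) * ((d : ℝ) + 2))

end

open MeasureTheory Matrix
open scoped Kronecker ComplexOrder

noncomputable section

/-! ### Third moments of Haar random pure states -/

section Moments

variable {d : ℕ}

/-! The third moment of a Haar random pure state is the normalized sum over the permutations of
three factors (`haarMoment_eq`), and the average fidelity is linear in each estimate. Hence `F(A ⊗
B)` is, up to `d (d + 1) (d + 2)`, the sum over `j, k` of the maximum of `permTrace (A_j) (B_k)`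
over pure states.

For `A_j = |a⟩⟨a|`, `B_k = |b⟩⟨b|`, put `x = ‖a‖ ‖b‖` and `y = |⟪a, b⟫|`. The maximum is `x² + y² +
(x + y)²`, attained at a top eigenvector of the sum of the two normalized projectors. By AM-GM, `2 x
y ≤ c x² + c⁻¹ y²`; this makes the bound bilinear in the operators, so it extends to all positive
semidefinite elements (`operatorGap_nonneg`). Since `∑ tr A_j tr B_k = d²` and `∑ tr (A_j B_k) = d`,
the choice `c = 1 / √d` bounds the fidelity by `fidelitySep d`.

Equality makes every gap vanish. This forces elements of rank at most one
(`exists_eq_ketbra_of_operatorGap_eq_zero`) and `y = x / √d`, which is mutual unbiasedness. For such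
elements, `F(A ⊗ A) = 2 / (d + 1)` says `∑ y (x - y) = 0` over pairs from `A`, so any two elements
are orthogonal or parallel; simplicity excludes the latter, which gives projectivity. The other
direction evaluates the same formula on orthonormal bases. -/

instance (d : ℕ) : IsProbabilityMeasure (haarUnitary d) :=
  ⟨by
    simpa [haarUnitary] using Measure.haarMeasure_self
      (K₀ := (⊤ : TopologicalSpace.PositiveCompacts (unitaryGroup (Fin d) ℂ)))⟩

instance (d : ℕ) : (haarUnitary d).IsMulLeftInvariant := by
  unfold haarUnitary; infer_instance

theorem continuous_pureState [NeZero d] :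
    Continuous (pureState : unitaryGroup (Fin d) ℂ → Matrix (Fin d) (Fin d) ℂ) := by
  have h : Continuous fun U : unitaryGroup (Fin d) ℂ => U.1 *ᵥ Pi.single (0 : Fin d) (1 : ℂ) :=
    continuous_subtype_val.matrix_mulVec continuous_const
  exact h.matrix_vecMulVec h.star

theorem integrable_of_continuous {f : unitaryGroup (Fin d) ℂ → ℂ} (hf : Continuous f) :
    Integrable f (haarUnitary d) :=
  hf.integrable_of_hasCompactSupport (HasCompactSupport.of_compactSpace f)

theorem pureState_mul [NeZero d] (V U : unitaryGroup (Fin d) ℂ) :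
    pureState (V * U) = V.1 * pureState U * star V.1 := by
  simp only [pureState, Submonoid.coe_mul, ← mulVec_mulVec]
  rw [mul_vecMulVec, vecMulVec_mul, star_mulVec, star_eq_conjTranspose]

theorem pureState_mul_mul_self [NeZero d] (U : unitaryGroup (Fin d) ℂ)
    (M : Matrix (Fin d) (Fin d) ℂ) :
    pureState U * M * pureState U = (pureState U * M).trace • pureState U := by
  simp only [pureState]
  rw [vecMulVec_mul, vecMulVec_mul_vecMulVec, trace_vecMulVec, dotProduct_comm, vecMulVec_smul]

theorem trace_pureState [NeZero d] (U : unitaryGroup (Fin d) ℂ) :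
    (pureState U).trace = 1 := by
  have h : star U.1 * U.1 = 1 := (mem_unitaryGroup_iff').mp U.2
  rw [pureState, trace_vecMulVec, dotProduct_comm, star_mulVec, ← dotProduct_mulVec,
    mulVec_mulVec, ← star_eq_conjTranspose, h]
  simp

theorem isHermitian_pureState [NeZero d] (U : unitaryGroup (Fin d) ℂ) :
    (pureState U).IsHermitian := by
  simp [pureState, IsHermitian, conjTranspose_vecMulVec]

/-- The third moment `∫ tr(ρA) tr(ρB) tr(ρC)` of a Haar random pure state. -/
def haarMoment [NeZero d] (A B C : Matrix (Fin d) (Fin d) ℂ) : ℂ :=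
  ∫ U, (pureState U * A).trace * (pureState U * B).trace * (pureState U * C).trace ∂(haarUnitary d)

/-- The derivative of `tr(ρA) tr(ρB) tr(ρC)` in the direction of the commutator `[X, ρ]`. -/
def commutatorDeriv (X A B C ρ : Matrix (Fin d) (Fin d) ℂ) : ℂ :=
  ((X * ρ - ρ * X) * A).trace * (ρ * B).trace * (ρ * C).trace +
    (ρ * A).trace * ((X * ρ - ρ * X) * B).trace * (ρ * C).trace +
    (ρ * A).trace * (ρ * B).trace * ((X * ρ - ρ * X) * C).trace

theorem continuous_commutatorDeriv [NeZero d] (X A B C : Matrix (Fin d) (Fin d) ℂ) :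
    Continuous fun U : unitaryGroup (Fin d) ℂ => commutatorDeriv X A B C (pureState U) := by
  have h := continuous_pureState (d := d)
  unfold commutatorDeriv
  fun_prop

/-! ### Differentiation along one-parameter unitary groups. -/

section Deriv

attribute [local instance] Matrix.linftyOpNormedRing Matrix.linftyOpNormedAlgebra

theorem hasDerivAt_trace_conj (ρ A W' : Matrix (Fin d) (Fin d) ℂ)
    {W : ℝ → Matrix (Fin d) (Fin d) ℂ} {t : ℝ} (hW : HasDerivAt W W' t) :
    HasDerivAt (fun s => (W s * ρ * star (W s) * A).trace)
      ((W' * ρ * star (W t) + W t * ρ * star W') * A).trace t := by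
  have hs : HasDerivAt (fun s => star (W s)) (star W') t := by
    let L : Matrix (Fin d) (Fin d) ℂ →L[ℝ] Matrix (Fin d) (Fin d) ℂ :=
      ⟨(starLinearEquiv ℝ : Matrix (Fin d) (Fin d) ℂ ≃ₗ⋆[ℝ] _).toLinearMap, continuous_star⟩
    exact L.hasFDerivAt.comp_hasDerivAt t hW
  have h := ((hW.mul_const ρ).mul hs).mul_const A
  let L : Matrix (Fin d) (Fin d) ℂ →L[ℝ] ℂ :=
    ⟨traceLinearMap (Fin d) ℝ ℂ, by
      show Continuous fun M : Matrix (Fin d) (Fin d) ℂ => M.trace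
      fun_prop⟩
  exact L.hasFDerivAt.comp_hasDerivAt t h

/-- The flow is `exp (t • X)`, unitary because `X` is skew-adjoint; `star X = -X` also turns the
derivative of the conjugation into a commutator. -/
theorem exists_unitary_flow {X : Matrix (Fin d) (Fin d) ℂ} (hX : star X = -X) :
    ∃ W : ℝ → unitaryGroup (Fin d) ℂ, W 0 = 1 ∧ ∀ (ρ A : Matrix (Fin d) (Fin d) ℂ) (t : ℝ),
      HasDerivAt (fun s => ((W s).1 * ρ * star (W s).1 * A).trace)
        ((X * ((W t).1 * ρ * star (W t).1) - ((W t).1 * ρ * star (W t).1) * X) * A).trace t := by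
  let _ : NormedAlgebra ℚ (Matrix (Fin d) (Fin d) ℂ) := NormedAlgebra.restrictScalars ℚ ℝ _
  have : @ContinuousStar (Matrix (Fin d) (Fin d) ℂ)
      PseudoMetricSpace.toUniformSpace.toTopologicalSpace _ :=
    ⟨continuous_id.matrix_conjTranspose⟩
  have hmem : ∀ t : ℝ, NormedSpace.exp (t • X) ∈ unitaryGroup (Fin d) ℂ := fun t => by
    apply NormedSpace.exp_mem_unitary_of_mem_skewAdjoint
    rw [skewAdjoint.mem_iff, star_smul, hX]
    simp
  refine ⟨fun t => ⟨_, hmem t⟩, ?_, fun ρ A t => ?_⟩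
  · ext1; simp
  · have := hasDerivAt_trace_conj ρ A _ (hasDerivAt_exp_smul_const' (𝕂 := ℝ) X t)
    refine this.congr_deriv ?_
    rw [star_mul, hX]
    congr 1
    noncomm_ring

end Deriv

/-- Left invariance makes `t ↦ ∫ Φ (W t * U)` constant, and its derivative at `0` is this integral.
Compactness of the group gives a constant dominating function, uniform in `t`. -/
theorem integral_commutatorDeriv_of_skew [NeZero d] {X : Matrix (Fin d) (Fin d) ℂ}
    (hX : star X = -X) (A B C : Matrix (Fin d) (Fin d) ℂ) :
    ∫ U, commutatorDeriv X A B C (pureState U) ∂(haarUnitary d) = 0 := by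
  obtain ⟨W, hW0, hW⟩ := exists_unitary_flow hX
  have hρ := continuous_pureState (d := d)
  have hΨ := continuous_commutatorDeriv X A B C
  obtain ⟨K, hK⟩ := isCompact_univ.exists_bound_of_continuousOn hΨ.continuousOn
  let Φ : unitaryGroup (Fin d) ℂ → ℂ := fun U =>
    (pureState U * A).trace * (pureState U * B).trace * (pureState U * C).trace
  have hΦ : Continuous Φ := by unfold Φ; fun_prop
  have hd : ∀ U t, HasDerivAt (fun s => Φ (W s * U))
      (commutatorDeriv X A B C (pureState (W t * U))) t := fun U t => by
    have h := ((hW (pureState U) A t).mul (hW (pureState U) B t)).mul (hW (pureState U) C t)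
    simp only [Φ, pureState_mul, commutatorDeriv]
    refine h.congr_deriv ?_
    simp only [Pi.mul_apply]
    ring
  have key := (hasDerivAt_integral_of_dominated_loc_of_deriv_le (μ := haarUnitary d)
    (F := fun t U => Φ (W t * U)) (F' := fun t U => commutatorDeriv X A B C (pureState (W t * U)))
    (x₀ := (0 : ℝ)) (bound := fun _ => K) Filter.univ_mem
    (Filter.Eventually.of_forall fun t =>
      (hΦ.comp (continuous_const.mul continuous_id)).aestronglyMeasurable)
    (integrable_of_continuous (hΦ.comp (continuous_const.mul continuous_id)))
    (hΨ.comp (continuous_const.mul continuous_id)).aestronglyMeasurable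
    (Filter.Eventually.of_forall fun U t _ => hK _ (Set.mem_univ _))
    (integrable_const K)
    (Filter.Eventually.of_forall fun U t _ => hd U t)).2
  have hc : (fun t => ∫ U, Φ (W t * U) ∂(haarUnitary d)) =
      fun _ => ∫ U, Φ U ∂(haarUnitary d) := by
    funext t
    exact integral_mul_left_eq_self Φ (W t)
  rw [hc] at key
  have := key.unique (hasDerivAt_const _ _)
  simpa [hW0] using this

theorem integral_commutatorDeriv [NeZero d] (X A B C : Matrix (Fin d) (Fin d) ℂ) :
    ∫ U, commutatorDeriv X A B C (pureState U) ∂(haarUnitary d) = 0 := by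
  have h1 := integral_commutatorDeriv_of_skew (X := X - star X) (by simp) A B C
  have h2 := integral_commutatorDeriv_of_skew (X := Complex.I • (X + star X))
    (by simp [star_smul, add_comm]) A B C
  -- The derivative is complex linear in `X`, and every matrix is a complex combination of two
  -- skew-adjoint ones.
  have hX : ∀ ρ, commutatorDeriv X A B C ρ = (1 / 2) * commutatorDeriv (X - star X) A B C ρ +
      (-Complex.I / 2) * commutatorDeriv (Complex.I • (X + star X)) A B C ρ := fun ρ => by
    simp only [commutatorDeriv, sub_mul, add_mul, mul_sub, mul_add, smul_mul, Matrix.mul_smul,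
      trace_sub, trace_add, trace_smul, smul_eq_mul, smul_add]
    ring_nf
    simp only [Complex.I_sq]
    ring
  simp_rw [hX]
  rw [integral_add ((integrable_of_continuous (continuous_commutatorDeriv _ A B C)).const_mul _)
    ((integrable_of_continuous (continuous_commutatorDeriv _ A B C)).const_mul _),
    integral_const_mul, integral_const_mul, h1, h2]
  simp

theorem sum_trace_single_mul_trace_single_mul (M N : Matrix (Fin d) (Fin d) ℂ) :
    ∑ k, ∑ l, (single k l 1 * M).trace * (single l k 1 * N).trace = (M * N).trace := by
  simp only [trace_single_mul, smul_eq_mul, one_mul]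
  simp only [trace, diag, mul_apply]
  rw [Finset.sum_comm]

/-- The sum of `single k l 1 ⊗ single l k 1` is the swap operator, so summing contracts products of
traces into traces of products. The purity relation `hρ` then brings every term back to degree three
in `ρ`; the factors `tr (ρ * 1)` are kept so that each term is the integrand of a `haarMoment`. -/
theorem sum_commutatorDeriv_single (A B C ρ : Matrix (Fin d) (Fin d) ℂ)
    (htr : ρ.trace = 1) (hρ : ∀ M, ρ * M * ρ = (ρ * M).trace • ρ) :
    ∑ k, ∑ l, commutatorDeriv (single k l 1) (single l k 1 * A) B C ρ =
      A.trace * ((ρ * 1).trace * (ρ * B).trace * (ρ * C).trace)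
      - (d + 2) * ((ρ * A).trace * (ρ * B).trace * (ρ * C).trace)
      + (ρ * 1).trace * (ρ * (B * A)).trace * (ρ * C).trace
      + (ρ * 1).trace * (ρ * (C * A)).trace * (ρ * B).trace := by
  have e1 : ∑ k, ∑ l, ((single k l (1 : ℂ) * ρ - ρ * single k l 1) * (single l k 1 * A)).trace =
      A.trace - d * (ρ * A).trace := by
    have : ∀ k l, ((single k l (1 : ℂ) * ρ - ρ * single k l 1) * (single l k 1 * A)).trace =
        ρ l l * A k k - (A * ρ) k k := fun k l => by
      rw [sub_mul, trace_sub, ← mul_assoc, single_mul_mul_single, mul_assoc ρ,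
        ← mul_assoc (single k l _), single_mul_single_same, trace_mul_comm ρ, mul_assoc,
        mul_assoc, trace_single_mul, trace_single_mul]
      simp
    simp only [this, Finset.sum_sub_distrib, ← Finset.sum_mul, Finset.sum_const]
    rw [trace_mul_comm ρ]
    have h1 : ∑ l, ρ l l = 1 := htr
    simp [h1, trace, ← Finset.mul_sum]
  have e2 : ∀ M : Matrix (Fin d) (Fin d) ℂ, ∑ k, ∑ l, (ρ * (single l k (1 : ℂ) * A)).trace *
      ((single k l 1 * ρ - ρ * single k l 1) * M).trace =
      (ρ * (M * A)).trace - (ρ * A).trace * (ρ * M).trace := fun M => by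
    have : ∀ k l, (ρ * (single l k (1 : ℂ) * A)).trace *
        ((single k l 1 * ρ - ρ * single k l 1) * M).trace =
        (single k l 1 * (ρ * M - M * ρ)).trace * (single l k 1 * (A * ρ)).trace := fun k l => by
      rw [trace_mul_comm ρ, mul_assoc, mul_comm]
      congr 1
      rw [sub_mul, mul_sub, trace_sub, trace_sub, mul_assoc, mul_assoc, trace_mul_comm ρ, mul_assoc]
    simp_rw [this]
    rw [sum_trace_single_mul_trace_single_mul, sub_mul, trace_sub]
    congr 1
    · rw [mul_assoc, ← mul_assoc M, ← mul_assoc, hρ, trace_smul, htr, smul_eq_mul, mul_one]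
    · rw [mul_assoc, ← mul_assoc ρ, hρ, mul_smul_comm, trace_smul, smul_eq_mul, trace_mul_comm M]
  simp only [commutatorDeriv, Finset.sum_add_distrib, ← Finset.sum_mul, e1, e2]
  have e3 := e2 C
  have : ∀ k l, (ρ * (single l k (1 : ℂ) * A)).trace * (ρ * B).trace *
        ((single k l 1 * ρ - ρ * single k l 1) * C).trace = (ρ * (single l k (1 : ℂ) * A)).trace *
        ((single k l 1 * ρ - ρ * single k l 1) * C).trace * (ρ * B).trace := fun k l => by ring
  simp only [this, ← Finset.sum_mul, e3, mul_one, htr]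
  ring

/-- Integration by parts on the unitary group: one argument is traded for the identity, so iteration
ends at `haarMoment 1 1 1 = 1`. -/
theorem haarMoment_recursion [NeZero d] (A B C : Matrix (Fin d) (Fin d) ℂ) :
    ((d : ℂ) + 2) * haarMoment A B C = A.trace * haarMoment 1 B C + haarMoment 1 (B * A) C +
      haarMoment 1 (C * A) B := by
  have hρ := continuous_pureState (d := d)
  have hi : ∀ A B C : Matrix (Fin d) (Fin d) ℂ, Integrable (fun U => (pureState U * A).trace *
      (pureState U * B).trace * (pureState U * C).trace) (haarUnitary d) := fun A B C =>
    integrable_of_continuous (by fun_prop)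
  have h : ∫ U, ∑ k, ∑ l, commutatorDeriv (single k l 1) (single l k 1 * A) B C (pureState U)
      ∂(haarUnitary d) = 0 := by
    rw [integral_finsetSum _ fun k _ => integrable_finsetSum _ fun l _ =>
      integrable_of_continuous (continuous_commutatorDeriv _ _ _ _)]
    refine Finset.sum_eq_zero fun k _ => ?_
    rw [integral_finsetSum _ fun l _ =>
      integrable_of_continuous (continuous_commutatorDeriv _ _ _ _)]
    exact Finset.sum_eq_zero fun l _ => integral_commutatorDeriv _ _ _ _
  simp_rw [fun U => sum_commutatorDeriv_single A B C _ (trace_pureState U)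
    (pureState_mul_mul_self U)] at h
  unfold haarMoment
  have h1 := hi 1 B C
  have h2 := hi A B C
  have h3 := hi 1 (B * A) C
  have h4 := hi 1 (C * A) B
  have hsum := integral_add (((h1.const_mul A.trace).sub (h2.const_mul ((d : ℂ) + 2))).add h3) h4
  rw [integral_add' ((h1.const_mul _).sub (h2.const_mul _)) h3,
    integral_sub' (h1.const_mul _) (h2.const_mul _), integral_const_mul, integral_const_mul] at hsum
  have h' := hsum.symm.trans h
  linear_combination -h'

theorem haarMoment_swap_left [NeZero d] (A B C : Matrix (Fin d) (Fin d) ℂ) :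
    haarMoment A B C = haarMoment B A C := by
  simp only [haarMoment, mul_comm]

theorem haarMoment_swap_right [NeZero d] (A B C : Matrix (Fin d) (Fin d) ℂ) :
    haarMoment A B C = haarMoment A C B := by
  simp only [haarMoment, mul_right_comm]

/-- The sum of `tr ((A ⊗ B ⊗ C) W_σ)` over the permutation operators `W_σ` of three factors. -/
def permTrace {n : Type*} [Fintype n] (A B C : Matrix n n ℂ) : ℂ :=
  A.trace * B.trace * C.trace + (A * B).trace * C.trace + (A * C).trace * B.trace +
    (B * C).trace * A.trace + (A * B * C).trace + (B * A * C).trace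

theorem haarMoment_eq [NeZero d] (A B C : Matrix (Fin d) (Fin d) ℂ) :
    haarMoment A B C = permTrace A B C / ((d : ℂ) * (d + 1) * (d + 2)) := by
  have h0 : (d : ℂ) ≠ 0 := by exact_mod_cast NeZero.ne d
  have h1 : (d : ℂ) + 1 ≠ 0 := by exact_mod_cast Nat.succ_ne_zero d
  have h2 : (d : ℂ) + 2 ≠ 0 := by exact_mod_cast Nat.succ_ne_zero (d + 1)
  have m0 : haarMoment (1 : Matrix (Fin d) (Fin d) ℂ) 1 1 = 1 := by
    simp [haarMoment, trace_pureState]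
  have m1 : ∀ A : Matrix (Fin d) (Fin d) ℂ, haarMoment 1 1 A = A.trace / d := fun A => by
    have h := haarMoment_recursion A 1 1
    rw [one_mul, haarMoment_swap_left, haarMoment_swap_right, m0] at h
    field_simp
    linear_combination h
  have m2 : ∀ A B : Matrix (Fin d) (Fin d) ℂ, haarMoment 1 A B =
      (A.trace * B.trace + (B * A).trace) / (d * (d + 1)) := fun A B => by
    have h := haarMoment_recursion A 1 B
    rw [one_mul, haarMoment_swap_left A, haarMoment_swap_right 1 (B * A) 1, m1, m1] at h
    field_simp at h ⊢
    linear_combination h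
  have h := haarMoment_recursion A B C
  rw [m2, m2, m2] at h
  rw [permTrace]
  have e1 : (C * (B * A)).trace = (B * A * C).trace := trace_mul_comm _ _
  have e2 : (B * (C * A)).trace = (A * B * C).trace := by
    rw [← mul_assoc, trace_mul_comm, mul_assoc]
  rw [e1, e2, trace_mul_comm B A, trace_mul_comm C A, trace_mul_comm C B] at h
  field_simp at h ⊢
  linear_combination h

end Moments

/-! ### An inequality for three vectors -/

section Vectors

variable {E : Type*} [NormedAddCommGroup E] [InnerProductSpace ℂ E]

local notation "⟪" x ", " y "⟫" => inner ℂ x y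

/-- The expectation value in `v` of `‖b‖² |a⟩⟨a| + ‖a‖² |b⟩⟨b| + |a⟩⟨a|b⟩⟨b| + |b⟩⟨b|a⟩⟨a|`. -/
def anticommForm (a b v : E) : ℝ :=
  ‖b‖ ^ 2 * ‖⟪a, v⟫‖ ^ 2 + ‖a‖ ^ 2 * ‖⟪b, v⟫‖ ^ 2 + 2 * (⟪v, a⟫ * ⟪a, b⟫ * ⟪b, v⟫).re

theorem anticommForm_smul (r s : ℝ) (a b v : E) :
    anticommForm ((r : ℂ) • a) ((s : ℂ) • b) v = r ^ 2 * s ^ 2 * anticommForm a b v := by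
  have h : ⟪v, (r : ℂ) • a⟫ * ⟪(r : ℂ) • a, (s : ℂ) • b⟫ * ⟪(s : ℂ) • b, v⟫ =
      ((r ^ 2 * s ^ 2 : ℝ) : ℂ) * (⟪v, a⟫ * ⟪a, b⟫ * ⟪b, v⟫) := by
    simp only [inner_smul_left, inner_smul_right, Complex.conj_ofReal]
    push_cast
    ring
  rw [anticommForm, h, Complex.re_ofReal_mul]
  simp only [inner_smul_left, norm_smul, norm_mul, Complex.conj_ofReal, Complex.norm_real,
    mul_pow, Real.norm_eq_abs, sq_abs, anticommForm]
  ring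

/-- The vector `v₀` is used only when `a = 0`, so that later normalizations need no case
distinction. -/
theorem exists_unit_smul (v₀ : E) (h₀ : ‖v₀‖ = 1) (a : E) :
    ∃ u : E, ‖u‖ = 1 ∧ a = ((‖a‖ : ℝ) : ℂ) • u := by
  by_cases ha : a = 0
  · exact ⟨v₀, h₀, by simp [ha]⟩
  · refine ⟨((‖a‖⁻¹ : ℝ) : ℂ) • a, ?_, ?_⟩
    · have : ‖a‖ ≠ 0 := norm_ne_zero_iff.mpr ha
      simp [norm_smul, this]
    · have : ((‖a‖ : ℝ) : ℂ) ≠ 0 := by exact_mod_cast norm_ne_zero_iff.mpr ha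
      rw [smul_smul]
      push_cast
      rw [mul_inv_cancel₀ this, one_smul]

/-- With `P = |a⟩⟨a|` and `Q = |b⟩⟨b|`, both sides are `⟪v, (P + Q)² v⟫`. The sharp bounds below
reflect that the norm of `P + Q` is `1 + |⟪a, b⟫|`. -/
theorem norm_sq_add_inner_smul {a b : E} (ha : ‖a‖ = 1) (hb : ‖b‖ = 1) (v : E) :
    ‖⟪a, v⟫ • a + ⟪b, v⟫ • b‖ ^ 2 = anticommForm a b v := by
  rw [norm_add_sq (𝕜 := ℂ), norm_smul, norm_smul, ha, hb, inner_smul_left, inner_smul_right,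
    anticommForm, ha, hb, inner_conj_symm]
  have : ⟪v, a⟫ * (⟪b, v⟫ * ⟪a, b⟫) = ⟪v, a⟫ * ⟪a, b⟫ * ⟪b, v⟫ := by ring
  rw [this, RCLike.re_eq_complex_re]
  ring

theorem anticommForm_le_of_unit {a b v : E} (ha : ‖a‖ = 1) (hb : ‖b‖ = 1) :
    anticommForm a b v ≤ (1 + ‖⟪a, b⟫‖) * (‖⟪a, v⟫‖ ^ 2 + ‖⟪b, v⟫‖ ^ 2) := by
  have h : (⟪v, a⟫ * ⟪a, b⟫ * ⟪b, v⟫).re ≤ ‖⟪a, v⟫‖ * ‖⟪a, b⟫‖ * ‖⟪b, v⟫‖ := by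
    refine (Complex.re_le_norm _).trans ?_
    rw [norm_mul, norm_mul, norm_inner_symm v a]
  rw [anticommForm, ha, hb]
  nlinarith [mul_nonneg (norm_nonneg ⟪a, b⟫) (sq_nonneg (‖⟪a, v⟫‖ - ‖⟪b, v⟫‖))]

theorem inner_add_inner_smul (a b v : E) :
    ⟪v, ⟪a, v⟫ • a + ⟪b, v⟫ • b⟫ = ((‖⟪a, v⟫‖ ^ 2 + ‖⟪b, v⟫‖ ^ 2 : ℝ) : ℂ) := by
  rw [inner_add_right, inner_smul_right, inner_smul_right, ← inner_conj_symm v a,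
    ← inner_conj_symm v b, Complex.mul_conj', Complex.mul_conj']
  push_cast
  rfl

/-- For `N = ⟪v, (P + Q) v⟫`, Cauchy–Schwarz gives `N² ≤ ‖(P + Q) v‖² ≤ (1 + |⟪a, b⟫|) N`. -/
theorem norm_inner_sq_add_le {a b v : E} (ha : ‖a‖ = 1) (hb : ‖b‖ = 1) (hv : ‖v‖ = 1) :
    ‖⟪a, v⟫‖ ^ 2 + ‖⟪b, v⟫‖ ^ 2 ≤ 1 + ‖⟪a, b⟫‖ := by
  set N := ‖⟪a, v⟫‖ ^ 2 + ‖⟪b, v⟫‖ ^ 2 with hN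
  have h1 : N ≤ ‖⟪a, v⟫ • a + ⟪b, v⟫ • b‖ := by
    have h := norm_inner_le_norm (𝕜 := ℂ) v (⟪a, v⟫ • a + ⟪b, v⟫ • b)
    rw [inner_add_inner_smul, hv, one_mul, Complex.norm_real] at h
    exact (Real.le_norm_self _).trans h
  have h2 := anticommForm_le_of_unit (v := v) ha hb
  rw [← norm_sq_add_inner_smul ha hb] at h2
  have hN0 : 0 ≤ N := by positivity
  have h3 : N ^ 2 ≤ (1 + ‖⟪a, b⟫‖) * N := (pow_le_pow_left₀ hN0 h1 2).trans h2
  by_contra! h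
  have : 0 < N := lt_of_le_of_lt (by positivity) h
  nlinarith

theorem anticommForm_le_sq_of_unit {a b v : E} (ha : ‖a‖ = 1) (hb : ‖b‖ = 1) (hv : ‖v‖ = 1) :
    anticommForm a b v ≤ (1 + ‖⟪a, b⟫‖) ^ 2 := by
  rw [sq]
  exact (anticommForm_le_of_unit ha hb).trans
    (mul_le_mul_of_nonneg_left (norm_inner_sq_add_le ha hb hv) (by positivity))

theorem anticommForm_le_sq {a b v : E} (hv : ‖v‖ = 1) :
    anticommForm a b v ≤ (‖a‖ * ‖b‖ + ‖⟪a, b⟫‖) ^ 2 := by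
  obtain ⟨a', ha', ha⟩ := exists_unit_smul v hv a
  obtain ⟨b', hb', hb⟩ := exists_unit_smul v hv b
  have h := anticommForm_le_sq_of_unit ha' hb' hv
  have h' : ‖⟪a, b⟫‖ = ‖a‖ * ‖b‖ * ‖⟪a', b'⟫‖ := by
    conv_lhs => rw [ha, hb]
    rw [inner_smul_left, inner_smul_right, norm_mul, norm_mul, Complex.conj_ofReal,
      Complex.norm_real, Complex.norm_real, norm_norm, norm_norm]
    ring
  have h'' : anticommForm a b v = ‖a‖ ^ 2 * ‖b‖ ^ 2 * anticommForm a' b' v := by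
    conv_lhs => rw [ha, hb]
    exact anticommForm_smul _ _ _ _ _
  rw [h', h'']
  calc _ ≤ ‖a‖ ^ 2 * ‖b‖ ^ 2 * (1 + ‖⟪a', b'⟫‖) ^ 2 := by gcongr
    _ = _ := by ring

theorem exists_phase (z : ℂ) : ∃ ω : ℂ, ‖ω‖ = 1 ∧ z * ω = (‖z‖ : ℂ) := by
  by_cases hz : z = 0
  · exact ⟨1, by simp, by simp [hz]⟩
  · have h : (‖z‖ : ℂ) ≠ 0 := by exact_mod_cast norm_ne_zero_iff.mpr hz
    refine ⟨(starRingEnd ℂ) z / ‖z‖, ?_, ?_⟩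
    · simp [hz]
    · rw [mul_div_assoc', Complex.mul_conj', sq, mul_div_assoc, div_self h, mul_one]

theorem exists_anticommForm_eq_sq (v₀ : E) (h₀ : ‖v₀‖ = 1) (a b : E) :
    ∃ v : E, ‖v‖ = 1 ∧ anticommForm a b v = (‖a‖ * ‖b‖ + ‖⟪a, b⟫‖) ^ 2 := by
  obtain ⟨a', ha', ha⟩ := exists_unit_smul v₀ h₀ a
  obtain ⟨b', hb', hb⟩ := exists_unit_smul v₀ h₀ b
  obtain ⟨ω, hω, hz⟩ := exists_phase ⟪a', b'⟫
  have hω' : (starRingEnd ℂ) ω * ω = 1 := by rw [Complex.conj_mul', hω]; simp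
  set s := ‖⟪a', b'⟫‖ with hs
  have hba : (starRingEnd ℂ) ω * ⟪b', a'⟫ = (s : ℂ) := by
    have := congrArg (starRingEnd ℂ) hz
    rw [map_mul, inner_conj_symm, Complex.conj_ofReal] at this
    rw [mul_comm, this]
  have haa : ⟪a', a'⟫ = 1 := by rw [inner_self_eq_norm_sq_to_K, ha']; simp
  have hbb : ⟪b', b'⟫ = 1 := by rw [inner_self_eq_norm_sq_to_K, hb']; simp
  have hs0 : 0 ≤ s := norm_nonneg _
  have hu : ‖a' + ω • b'‖ ^ 2 = 2 * (1 + s) := by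
    rw [norm_add_sq (𝕜 := ℂ), norm_smul, ha', hb', hω, inner_smul_right, mul_comm ω, hz,
      RCLike.re_eq_complex_re, Complex.ofReal_re]
    ring
  have hpos : 0 < ‖a' + ω • b'‖ := by
    refine lt_of_le_of_ne (norm_nonneg _) fun h => ?_
    rw [← h] at hu
    nlinarith
  set r := ‖a' + ω • b'‖ with hr
  -- The phase `ω` aligns `b'` with `a'`, so the normalized sum is an eigenvector of `P + Q` for the
  -- eigenvalue `1 + s`.
  refine ⟨((r⁻¹ : ℝ) : ℂ) • (a' + ω • b'), ?_, ?_⟩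
  · rw [norm_smul, Complex.norm_real, ← hr, Real.norm_of_nonneg (by positivity)]
    exact inv_mul_cancel₀ hpos.ne'
  · have e1 : ⟪a', ((r⁻¹ : ℝ) : ℂ) • (a' + ω • b')⟫ = ((r⁻¹ * (1 + s) : ℝ) : ℂ) := by
      rw [inner_smul_right, inner_add_right, inner_smul_right, mul_comm ω, hz, haa]
      push_cast
      rfl
    have e2 : ⟪b', ((r⁻¹ : ℝ) : ℂ) • (a' + ω • b')⟫ = ((r⁻¹ * (1 + s) : ℝ) : ℂ) * ω := by
      have : ⟪b', a'⟫ = s * ω := by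
        rw [← hba, mul_right_comm, hω', one_mul]
      rw [inner_smul_right, inner_add_right, inner_smul_right, hbb, this]
      push_cast
      ring
    have hform : anticommForm a' b' (((r⁻¹ : ℝ) : ℂ) • (a' + ω • b')) = (1 + s) ^ 2 := by
      rw [← norm_sq_add_inner_smul ha' hb', e1, e2, mul_smul, ← smul_add, norm_smul,
        Complex.norm_real, ← hr, Real.norm_of_nonneg (by positivity)]
      field_simp
    have h' : ‖⟪a, b⟫‖ = ‖a‖ * ‖b‖ * s := by
      conv_lhs => rw [ha, hb]
      rw [inner_smul_left, inner_smul_right, norm_mul, norm_mul, Complex.conj_ofReal,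
        Complex.norm_real, Complex.norm_real, norm_norm, norm_norm]
      ring
    have h'' := anticommForm_smul ‖a‖ ‖b‖ a' b' (((r⁻¹ : ℝ) : ℂ) • (a' + ω • b'))
    rw [← ha, ← hb, hform] at h''
    rw [h'', h']
    ring

/-- The linearized upper bound for `anticommForm`, tangent at overlap `c`. -/
def overlapGap (c : ℝ) (a b v : E) : ℝ :=
  (1 + c) * (‖a‖ ^ 2 * ‖b‖ ^ 2) + (1 + c⁻¹) * ‖⟪a, b⟫‖ ^ 2 - anticommForm a b v

/-- Splits the gap into the AM-GM defect and the defect of the norm bound. Both are nonnegative for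
unit `v`, so a zero gap makes both vanish. -/
theorem overlapGap_eq {c : ℝ} (hc : 0 < c) (a b v : E) :
    overlapGap c a b v = c⁻¹ * (‖⟪a, b⟫‖ - c * (‖a‖ * ‖b‖)) ^ 2 +
      ((‖a‖ * ‖b‖ + ‖⟪a, b⟫‖) ^ 2 - anticommForm a b v) := by
  rw [overlapGap]
  field_simp
  ring

theorem overlapGap_nonneg {c : ℝ} (hc : 0 < c) (a b : E) {v : E} (hv : ‖v‖ = 1) :
    0 ≤ overlapGap c a b v := by
  rw [overlapGap_eq hc]
  have := anticommForm_le_sq (a := a) (b := b) hv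
  have : 0 ≤ c⁻¹ * (‖⟪a, b⟫‖ - c * (‖a‖ * ‖b‖)) ^ 2 := by positivity
  linarith

theorem norm_inner_of_overlapGap_eq_zero {c : ℝ} (hc : 0 < c) {a b v : E} (hv : ‖v‖ = 1)
    (h : overlapGap c a b v = 0) : ‖⟪a, b⟫‖ = c * (‖a‖ * ‖b‖) := by
  rw [overlapGap_eq hc] at h
  have h1 := anticommForm_le_sq (a := a) (b := b) hv
  have h2 : 0 ≤ c⁻¹ * (‖⟪a, b⟫‖ - c * (‖a‖ * ‖b‖)) ^ 2 := by positivity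
  have h3 : c⁻¹ * (‖⟪a, b⟫‖ - c * (‖a‖ * ‖b‖)) ^ 2 = 0 := by linarith
  have h4 : (‖⟪a, b⟫‖ - c * (‖a‖ * ‖b‖)) ^ 2 = 0 :=
    (mul_eq_zero.mp h3).resolve_left (inv_ne_zero hc.ne')
  linarith [pow_eq_zero_iff (two_ne_zero) |>.mp h4]

/-- Equality forces `(P + Q) v = (1 + s) v`; removing the component `⟪b, v⟫ • b` leaves `⟪a, v⟫ •
a`. If `⟪a, v⟫` were zero, the eigenvalue equation paired with `a` would give `⟪b, v⟫ = 0` or `s =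
0`, both impossible. -/
theorem eq_smul_of_anticommForm_eq {a b v : E} (ha : ‖a‖ = 1) (hb : ‖b‖ = 1) (hv : ‖v‖ = 1)
    (hs : 0 < ‖⟪a, b⟫‖) (h : anticommForm a b v = (1 + ‖⟪a, b⟫‖) ^ 2) :
    ∃ μ : ℂ, a = μ • (((1 + ‖⟪a, b⟫‖ : ℝ) : ℂ) • v - ⟪b, v⟫ • b) := by
  set s := ‖⟪a, b⟫‖ with hsdef
  set w := ⟪a, v⟫ • a + ⟪b, v⟫ • b with hw
  have hN : ‖⟪a, v⟫‖ ^ 2 + ‖⟪b, v⟫‖ ^ 2 = 1 + s := by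
    refine le_antisymm (norm_inner_sq_add_le ha hb hv) ?_
    have := anticommForm_le_of_unit (v := v) ha hb
    rw [h, sq] at this
    exact le_of_mul_le_mul_left this (by positivity)
  have hwv : w = ((1 + s : ℝ) : ℂ) • v := by
    rw [← sub_eq_zero, ← norm_eq_zero, ← sq_eq_zero_iff, norm_sub_sq (𝕜 := ℂ), norm_smul, hv,
      inner_smul_right, hw, norm_sq_add_inner_smul ha hb, h, ← inner_conj_symm,
      inner_add_inner_smul, hN, Complex.norm_real, Real.norm_of_nonneg (by positivity)]
    rw [Complex.conj_ofReal, ← Complex.ofReal_mul, RCLike.re_eq_complex_re, Complex.ofReal_re]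
    ring
  have hx : ⟪a, v⟫ ≠ 0 := by
    intro hx
    have h1 : ⟪a, w⟫ = ((1 + s : ℝ) : ℂ) * ⟪a, v⟫ := by rw [hwv, inner_smul_right]
    rw [hw, inner_add_right, inner_smul_right, inner_smul_right, hx, zero_mul, mul_zero, zero_add,
      mul_eq_zero] at h1
    rcases h1 with h1 | h1
    · rw [hx, h1] at hN
      simp at hN
      linarith
    · rw [hsdef, h1] at hs
      simp at hs
  refine ⟨⟪a, v⟫⁻¹, ?_⟩
  rw [← hwv, hw, add_sub_cancel_right, smul_smul, inv_mul_cancel₀ hx, one_smul]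

/-- For fixed unit `b`, `v`, all vectors saturating the overlap bound lie on one line. -/
theorem eq_smul_of_overlapGap_eq_zero {c : ℝ} (hc : 0 < c) {a b v : E} (hb : ‖b‖ = 1)
    (hv : ‖v‖ = 1) (h : overlapGap c a b v = 0) :
    ∃ μ : ℂ, a = μ • (((1 + c : ℝ) : ℂ) • v - ⟪b, v⟫ • b) := by
  by_cases ha : a = 0
  · exact ⟨0, by simp [ha]⟩
  have hna : 0 < ‖a‖ := norm_pos_iff.mpr ha
  have hs := norm_inner_of_overlapGap_eq_zero hc hv h
  obtain ⟨a', ha', haa'⟩ := exists_unit_smul v hv a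
  have h' : ‖⟪a, b⟫‖ = ‖a‖ * ‖⟪a', b⟫‖ := by
    conv_lhs => rw [haa']
    rw [inner_smul_left, norm_mul, Complex.conj_ofReal, Complex.norm_real, norm_norm]
  have hs' : ‖⟪a', b⟫‖ = c := by
    rw [h', hb, mul_one, mul_comm c] at hs
    exact mul_left_cancel₀ hna.ne' hs
  have hform : anticommForm a' b v = (1 + ‖⟪a', b⟫‖) ^ 2 := by
    rw [overlapGap_eq hc, hs, sub_self, hb] at h
    have h2 := anticommForm_smul ‖a‖ 1 a' b v
    rw [← haa'] at h2
    simp only [Complex.ofReal_one, one_smul] at h2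
    rw [h2] at h
    rw [hs']
    have h3 : ‖a‖ ^ 2 * ((1 + c) ^ 2 - anticommForm a' b v) = 0 := by linarith
    rcases mul_eq_zero.mp h3 with h4 | h4
    · exact absurd h4 (by positivity)
    · linarith
  obtain ⟨μ, hμ⟩ := eq_smul_of_anticommForm_eq ha' hb hv (by rw [hs']; exact hc) hform
  refine ⟨(‖a‖ : ℂ) * μ, ?_⟩
  rw [hs'] at hμ
  rw [mul_smul, ← hμ]
  exact haa'

end Vectors

/-! ### Rank-one operators -/

section Ketbra

variable {n : Type*} [Fintype n]

/-- The rank-one operator `|a⟩⟨a|`. -/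
def ketbra (a : EuclideanSpace ℂ n) : Matrix n n ℂ := vecMulVec a.ofLp (star a.ofLp)

theorem dotProduct_star_ofLp (a b : EuclideanSpace ℂ n) :
    a.ofLp ⬝ᵥ star b.ofLp = inner ℂ b a :=
  (EuclideanSpace.inner_eq_star_dotProduct b a).symm

theorem trace_ketbra (a : EuclideanSpace ℂ n) : (ketbra a).trace = ((‖a‖ ^ 2 : ℝ) : ℂ) := by
  rw [ketbra, trace_vecMulVec, dotProduct_star_ofLp, inner_self_eq_norm_sq_to_K]
  simp

theorem ketbra_mul_ketbra (a b : EuclideanSpace ℂ n) :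
    ketbra a * ketbra b = (inner ℂ a b : ℂ) • vecMulVec a.ofLp (star b.ofLp) := by
  rw [ketbra, ketbra, vecMulVec_mul_vecMulVec, vecMulVec_smul, dotProduct_comm,
    dotProduct_star_ofLp]

theorem trace_ketbra_mul_ketbra (a b : EuclideanSpace ℂ n) :
    (ketbra a * ketbra b).trace = ((‖(inner ℂ a b : ℂ)‖ ^ 2 : ℝ) : ℂ) := by
  rw [ketbra_mul_ketbra, trace_smul, trace_vecMulVec, dotProduct_star_ofLp, smul_eq_mul,
    ← inner_conj_symm b a, Complex.mul_conj']
  push_cast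
  rfl

theorem trace_ketbra_mul_ketbra_mul_ketbra (a b v : EuclideanSpace ℂ n) :
    (ketbra a * ketbra b * ketbra v).trace = inner ℂ v a * inner ℂ a b * inner ℂ b v := by
  rw [ketbra_mul_ketbra, smul_mul, ketbra, vecMulVec_mul_vecMulVec, vecMulVec_smul, trace_smul,
    trace_smul, trace_vecMulVec, dotProduct_comm (star _), dotProduct_star_ofLp,
    dotProduct_star_ofLp, smul_eq_mul, smul_eq_mul]
  ring

theorem ketbra_smul (r : ℂ) (a : EuclideanSpace ℂ n) :
    ketbra (r • a) = ((‖r‖ ^ 2 : ℝ) : ℂ) • ketbra a := by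
  have : ((‖r‖ ^ 2 : ℝ) : ℂ) = star r * r := by
    rw [Complex.star_def, Complex.conj_mul']; push_cast; rfl
  rw [this, ketbra, ketbra, WithLp.ofLp_smul, star_smul, vecMulVec_smul, smul_vecMulVec, smul_smul]

theorem posSemidef_ketbra (a : EuclideanSpace ℂ n) : (ketbra a).PosSemidef :=
  posSemidef_vecMulVec_self_star _

theorem re_permTrace_ketbra (a b v : EuclideanSpace ℂ n) (hv : ‖v‖ = 1) :
    (permTrace (ketbra a) (ketbra b) (ketbra v)).re =
      ‖a‖ ^ 2 * ‖b‖ ^ 2 + ‖(inner ℂ a b : ℂ)‖ ^ 2 + anticommForm a b v := by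
  have h : inner ℂ v b * inner ℂ b a * inner ℂ a v =
      (starRingEnd ℂ) (inner ℂ v a * inner ℂ a b * inner ℂ b v) := by
    simp only [map_mul, inner_conj_symm]
    ring
  simp only [permTrace, trace_ketbra, trace_ketbra_mul_ketbra, trace_ketbra_mul_ketbra_mul_ketbra,
    anticommForm, h, hv]
  simp only [Complex.add_re, Complex.conj_re, ← Complex.ofReal_mul, Complex.ofReal_re]
  ring

open scoped MatrixOrder in
theorem Matrix.PosSemidef.exists_eq_sum_ketbra {A : Matrix n n ℂ} (hA : A.PosSemidef) :
    ∃ a : n → EuclideanSpace ℂ n, A = ∑ i, ketbra (a i) := by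
  classical
  obtain ⟨C, rfl⟩ := CStarAlgebra.nonneg_iff_eq_star_mul_self.mp hA.nonneg
  refine ⟨fun i => WithLp.toLp 2 (star (C i)), ?_⟩
  ext x y
  simp [ketbra, Matrix.sum_apply, mul_apply, vecMulVec_apply]

end Ketbra

/-! ### The estimation fidelity of a product measurement -/

section Fidelity

variable {n : Type*} [Fintype n]

theorem im_trace_mul_eq_zero {A B : Matrix n n ℂ} (hA : A.IsHermitian) (hB : B.IsHermitian) :
    ((A * B).trace).im = 0 := by
  have h : star (A * B).trace = (A * B).trace := by
    rw [← trace_conjTranspose, conjTranspose_mul, hA.eq, hB.eq, trace_mul_comm]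
  exact Complex.conj_eq_iff_im.mp h

theorem permTrace_add_third (A B C D : Matrix n n ℂ) :
    permTrace A B (C + D) = permTrace A B C + permTrace A B D := by
  simp only [permTrace, mul_add, trace_add]
  ring

theorem permTrace_smul_third (A B C : Matrix n n ℂ) (r : ℂ) :
    permTrace A B (r • C) = r * permTrace A B C := by
  simp only [permTrace, mul_smul_comm, trace_smul, smul_eq_mul]
  ring

theorem permTrace_sum_third {ι : Type*} (s : Finset ι) (A B : Matrix n n ℂ)
    (C : ι → Matrix n n ℂ) : permTrace A B (∑ i ∈ s, C i) = ∑ i ∈ s, permTrace A B (C i) := by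
  classical
  induction s using Finset.induction_on with
  | empty => simp [permTrace]
  | insert i s hi ih => rw [Finset.sum_insert hi, Finset.sum_insert hi, permTrace_add_third, ih]

theorem continuous_ketbra {n : Type*} : Continuous (ketbra : EuclideanSpace ℂ n → Matrix n n ℂ) := by
  have h : Continuous fun a : EuclideanSpace ℂ n => a.ofLp := PiLp.continuous_ofLp 2 _
  exact h.matrix_vecMulVec h.star

theorem exists_norm_eq_one [Nonempty n] : ∃ v : EuclideanSpace ℂ n, ‖v‖ = 1 := by
  classical
  exact ⟨EuclideanSpace.single (Classical.arbitrary n) 1, by simp⟩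

theorem exists_isMax_permTrace [Nonempty n] (A B : Matrix n n ℂ) :
    ∃ v : EuclideanSpace ℂ n, ‖v‖ = 1 ∧ ∀ u : EuclideanSpace ℂ n, ‖u‖ = 1 →
      (permTrace A B (ketbra u)).re ≤ (permTrace A B (ketbra v)).re := by
  obtain ⟨v₀, h₀⟩ := exists_norm_eq_one (n := n)
  have hk := continuous_ketbra (n := n)
  have hc : Continuous fun u : EuclideanSpace ℂ n => (permTrace A B (ketbra u)).re := by
    unfold permTrace
    fun_prop
  obtain ⟨v, hv, hmax⟩ := (isCompact_sphere (0 : EuclideanSpace ℂ n) 1).exists_isMaxOn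
    ⟨v₀, by simpa using h₀⟩ hc.continuousOn
  exact ⟨v, by simpa using hv, fun u hu => hmax (by simpa using hu)⟩

/-- A density matrix is a convex combination of pure states and `permTrace` is linear in its third
argument. -/
theorem re_permTrace_le_of_density [Nonempty n] {A B : Matrix n n ℂ} {m : ℝ}
    (h : ∀ u : EuclideanSpace ℂ n, ‖u‖ = 1 → (permTrace A B (ketbra u)).re ≤ m)
    {σ : Matrix n n ℂ} (hσ : σ.PosSemidef) (htr : σ.trace = 1) :
    (permTrace A B σ).re ≤ m := by
  obtain ⟨v₀, h₀⟩ := exists_norm_eq_one (n := n)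
  obtain ⟨a, rfl⟩ := hσ.exists_eq_sum_ketbra
  have hsum : ∑ i, ‖a i‖ ^ 2 = 1 := by
    rw [trace_sum] at htr
    simp only [trace_ketbra] at htr
    exact_mod_cast htr
  rw [permTrace_sum_third, Complex.re_sum]
  calc _ ≤ ∑ i, ‖a i‖ ^ 2 * m := Finset.sum_le_sum fun i _ => by
        obtain ⟨u, hu, hau⟩ := exists_unit_smul v₀ h₀ (a i)
        conv_lhs => rw [hau]
        rw [ketbra_smul, permTrace_smul_third, Complex.re_ofReal_mul, Complex.norm_real, norm_norm]
        exact mul_le_mul_of_nonneg_left (h u hu) (by positivity)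
    _ = m := by rw [← Finset.sum_mul, hsum, one_mul]

variable {d : ℕ} [NeZero d] {ι κ : Type*} [Fintype ι] [Fintype κ]

theorem integral_fidelity_eq {A B C : Matrix (Fin d) (Fin d) ℂ} (hA : A.IsHermitian)
    (hB : B.IsHermitian) (hC : C.IsHermitian) :
    ∫ U, (((pureState U ⊗ₖ pureState U) * (A ⊗ₖ B)).trace).re * ((pureState U * C).trace).re
      ∂(haarUnitary d) = (permTrace A B C).re / ((d : ℝ) * (d + 1) * (d + 2)) := by
  have hρ := continuous_pureState (d := d)
  have h : ∀ U : unitaryGroup (Fin d) ℂ, (((pureState U ⊗ₖ pureState U) * (A ⊗ₖ B)).trace).re *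
      ((pureState U * C).trace).re =
      RCLike.re ((pureState U * A).trace * (pureState U * B).trace * (pureState U * C).trace) :=
    fun U => by
      -- Traces of products of two Hermitian matrices are real, so the product of real parts is the
      -- real part of the product.
      have hU := isHermitian_pureState U
      rw [← mul_kronecker_mul, trace_kronecker, RCLike.re_eq_complex_re]
      simp [Complex.mul_re, im_trace_mul_eq_zero hU hA, im_trace_mul_eq_zero hU hB,
        im_trace_mul_eq_zero hU hC]
  simp_rw [h]
  rw [integral_re (integrable_of_continuous (by fun_prop))]
  have := haarMoment_eq A B C
  rw [haarMoment] at this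
  rw [this, RCLike.re_eq_complex_re]
  have e : (d : ℂ) * (d + 1) * (d + 2) = (((d : ℝ) * (d + 1) * (d + 2) : ℝ) : ℂ) := by
    push_cast; rfl
  rw [e, Complex.div_ofReal_re]

theorem averageFidelity_tensor (A : POVM (Fin d) ι) (B : POVM (Fin d) κ)
    (est : ι × κ → DensityMatrix (Fin d)) :
    averageFidelity (A.tensor B) est =
      (∑ p, (permTrace (A.elem p.1) (B.elem p.2) (est p).1).re) /
        ((d : ℝ) * (d + 1) * (d + 2)) := by
  rw [averageFidelity, Finset.sum_div]
  exact Finset.sum_congr rfl fun p _ => integral_fidelity_eq (A.posSemidef _).isHermitian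
    (B.posSemidef _).isHermitian (est p).2.1.isHermitian

theorem estimationFidelity_tensor (A : POVM (Fin d) ι) (B : POVM (Fin d) κ)
    (v : ι × κ → EuclideanSpace ℂ (Fin d)) (hv : ∀ p, ‖v p‖ = 1)
    (hmax : ∀ p u, ‖u‖ = 1 → (permTrace (A.elem p.1) (B.elem p.2) (ketbra u)).re ≤
      (permTrace (A.elem p.1) (B.elem p.2) (ketbra (v p))).re) :
    estimationFidelity (A.tensor B) =
      (∑ p, (permTrace (A.elem p.1) (B.elem p.2) (ketbra (v p))).re) /
        ((d : ℝ) * (d + 1) * (d + 2)) := by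
  let est : ι × κ → DensityMatrix (Fin d) := fun p =>
    ⟨ketbra (v p), posSemidef_ketbra _, by rw [trace_ketbra, hv]; simp⟩
  have hle : ∀ e, averageFidelity (A.tensor B) e ≤ averageFidelity (A.tensor B) est := fun e => by
    rw [averageFidelity_tensor, averageFidelity_tensor]
    refine div_le_div_of_nonneg_right (Finset.sum_le_sum fun p _ => ?_) (by positivity)
    exact re_permTrace_le_of_density (hmax p) (e p).2.1 (e p).2.2
  rw [← averageFidelity_tensor A B est, estimationFidelity]
  have : Nonempty (ι × κ → DensityMatrix (Fin d)) := ⟨est⟩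
  -- The maximizer `est` also supplies the upper bound without which a real supremum takes a default
  -- value.
  exact le_antisymm (ciSup_le hle) (le_ciSup ⟨_, Set.forall_mem_range.mpr hle⟩ est)

theorem POVM.sum_trace {d : ℕ} {ι : Type*} [Fintype ι] (A : POVM (Fin d) ι) : ∑ j, (A.elem j).trace = d := by
  rw [← trace_sum, A.sum_elem]
  simp

theorem POVM.sum_trace_mul_trace {d : ℕ} {ι κ : Type*} [Fintype ι] [Fintype κ]
    (A : POVM (Fin d) ι) (B : POVM (Fin d) κ) :
    ∑ p : ι × κ, (A.elem p.1).trace * (B.elem p.2).trace = (d : ℂ) ^ 2 := by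
  rw [Fintype.sum_prod_type, sq]
  simp only [← Finset.mul_sum, ← Finset.sum_mul, POVM.sum_trace]

theorem POVM.sum_trace_mul {d : ℕ} {ι κ : Type*} [Fintype ι] [Fintype κ] (A : POVM (Fin d) ι) (B : POVM (Fin d) κ) :
    ∑ p : ι × κ, (A.elem p.1 * B.elem p.2).trace = (d : ℂ) := by
  rw [Fintype.sum_prod_type]
  simp only [← trace_sum, ← Finset.mul_sum, ← Finset.sum_mul, A.sum_elem, B.sum_elem]
  simp

/-- The estimation fidelity of a product of two POVMs whose elements have rank at most one. -/
theorem estimationFidelity_tensor_ketbra (A : POVM (Fin d) ι) (B : POVM (Fin d) κ)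
    (a : ι → EuclideanSpace ℂ (Fin d)) (b : κ → EuclideanSpace ℂ (Fin d))
    (ha : ∀ j, A.elem j = ketbra (a j)) (hb : ∀ k, B.elem k = ketbra (b k)) :
    estimationFidelity (A.tensor B) = ((d : ℝ) ^ 2 + d +
      ∑ p : ι × κ, (‖a p.1‖ * ‖b p.2‖ + ‖(inner ℂ (a p.1) (b p.2) : ℂ)‖) ^ 2) /
        ((d : ℝ) * (d + 1) * (d + 2)) := by
  obtain ⟨v₀, h₀⟩ := exists_norm_eq_one (n := Fin d)
  choose v hv hva using fun p : ι × κ => exists_anticommForm_eq_sq v₀ h₀ (a p.1) (b p.2)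
  have hval : ∀ (p : ι × κ) (u : EuclideanSpace ℂ (Fin d)), ‖u‖ = 1 → (permTrace (A.elem p.1) (B.elem p.2) (ketbra u)).re =
      ‖a p.1‖ ^ 2 * ‖b p.2‖ ^ 2 + ‖(inner ℂ (a p.1) (b p.2) : ℂ)‖ ^ 2 +
        anticommForm (a p.1) (b p.2) u := fun p u hu => by
    rw [ha, hb, re_permTrace_ketbra _ _ _ hu]
  rw [estimationFidelity_tensor A B v hv fun (p : ι × κ) u hu => by
    rw [hval p u hu, hval p _ (hv p), hva]
    have := anticommForm_le_sq (a := a p.1) (b := b p.2) hu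
    linarith]
  congr 1
  have h1 := POVM.sum_trace_mul_trace A B
  have h2 := POVM.sum_trace_mul A B
  simp only [ha, hb, trace_ketbra, trace_ketbra_mul_ketbra] at h1 h2
  norm_cast at h1 h2
  simp only [hval _ _ (hv _), hva, Finset.sum_add_distrib]
  rw [h1, h2]
  push_cast
  rfl

end Fidelity

/-! ### Saturation of the bound on the estimation fidelity -/

section Saturation

variable {n : Type*} [Fintype n]

/-- The bilinear extension of `overlapGap` to operators. -/
def operatorGap (c : ℝ) (A B C : Matrix n n ℂ) : ℝ :=
  ((((2 + c : ℝ) : ℂ) * (A.trace * B.trace) + ((2 + c⁻¹ : ℝ) : ℂ) * (A * B).trace) * C.trace -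
    permTrace A B C).re

/-- The coefficients `2 + c`, `2 + c⁻¹` replace `1 + c`, `1 + c⁻¹` to absorb the terms by which
`permTrace` exceeds `anticommForm`. -/
theorem operatorGap_ketbra (c : ℝ) (a b : EuclideanSpace ℂ n) {v : EuclideanSpace ℂ n}
    (hv : ‖v‖ = 1) : operatorGap c (ketbra a) (ketbra b) (ketbra v) = overlapGap c a b v := by
  rw [operatorGap, Complex.sub_re, re_permTrace_ketbra _ _ _ hv, overlapGap]
  simp only [trace_ketbra, trace_ketbra_mul_ketbra, hv]
  norm_cast
  ring

theorem operatorGap_comm (c : ℝ) (A B C : Matrix n n ℂ) :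
    operatorGap c A B C = operatorGap c B A C := by
  simp only [operatorGap, permTrace, trace_mul_comm B A]
  congr 1
  ring

theorem operatorGap_add_left (c : ℝ) (A A' B C : Matrix n n ℂ) :
    operatorGap c (A + A') B C = operatorGap c A B C + operatorGap c A' B C := by
  simp only [operatorGap, ← Complex.add_re, permTrace, add_mul, mul_add, trace_add]
  congr 1
  ring

theorem operatorGap_sum_left {ι : Type*} (s : Finset ι) (c : ℝ) (A : ι → Matrix n n ℂ)
    (B C : Matrix n n ℂ) :
    operatorGap c (∑ i ∈ s, A i) B C = ∑ i ∈ s, operatorGap c (A i) B C := by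
  classical
  induction s using Finset.induction_on with
  | empty => simp [operatorGap, permTrace]
  | insert i s hi ih => rw [Finset.sum_insert hi, Finset.sum_insert hi, operatorGap_add_left, ih]

theorem operatorGap_sum_sum {ι κ : Type*} [Fintype ι] [Fintype κ] (c : ℝ) (A : ι → Matrix n n ℂ)
    (B : κ → Matrix n n ℂ) (C : Matrix n n ℂ) :
    operatorGap c (∑ i, A i) (∑ k, B k) C = ∑ i, ∑ k, operatorGap c (A i) (B k) C := by
  rw [operatorGap_sum_left]
  refine Finset.sum_congr rfl fun i _ => ?_
  rw [operatorGap_comm, operatorGap_sum_left]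
  exact Finset.sum_congr rfl fun k _ => operatorGap_comm _ _ _ _

theorem operatorGap_nonneg {c : ℝ} (hc : 0 < c) {A B : Matrix n n ℂ} (hA : A.PosSemidef)
    (hB : B.PosSemidef) {v : EuclideanSpace ℂ n} (hv : ‖v‖ = 1) :
    0 ≤ operatorGap c A B (ketbra v) := by
  obtain ⟨a, rfl⟩ := hA.exists_eq_sum_ketbra
  obtain ⟨b, rfl⟩ := hB.exists_eq_sum_ketbra
  rw [operatorGap_sum_sum]
  refine Finset.sum_nonneg fun i _ => Finset.sum_nonneg fun k _ => ?_
  rw [operatorGap_ketbra _ _ _ hv]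
  exact overlapGap_nonneg hc _ _ hv

/-- Decomposing both operators into rank-one terms, every single gap vanishes. For one fixed nonzero
`b k`, all `a i` then lie on the line through a vector `z` depending only on `c`, `b k` and `v`, so
their projectors add up to a multiple of `|z⟩⟨z|`. -/
theorem exists_eq_ketbra_of_operatorGap_eq_zero {c : ℝ} (hc : 0 < c) {A B : Matrix n n ℂ}
    (hA : A.PosSemidef) (hB : B.PosSemidef) (hB0 : B ≠ 0) {v : EuclideanSpace ℂ n} (hv : ‖v‖ = 1)
    (h : operatorGap c A B (ketbra v) = 0) : ∃ a, A = ketbra a := by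
  obtain ⟨a, rfl⟩ := hA.exists_eq_sum_ketbra
  obtain ⟨b, rfl⟩ := hB.exists_eq_sum_ketbra
  obtain ⟨k, hk⟩ : ∃ k, b k ≠ 0 := by
    by_contra! hk
    exact hB0 (by simp [hk, ketbra])
  simp only [operatorGap_sum_sum, operatorGap_ketbra _ _ _ hv] at h
  have hi : ∀ i, overlapGap c (a i) (b k) v = 0 := fun i => by
    have h1 := (Finset.sum_eq_zero_iff_of_nonneg fun i _ =>
      Finset.sum_nonneg fun k _ => overlapGap_nonneg hc (a i) (b k) hv).mp h i (Finset.mem_univ i)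
    exact (Finset.sum_eq_zero_iff_of_nonneg fun k _ =>
      overlapGap_nonneg hc (a i) (b k) hv).mp h1 k (Finset.mem_univ k)
  obtain ⟨b', hb', hbb⟩ := exists_unit_smul v hv (b k)
  have hi' : ∀ i, overlapGap c (a i) b' v = 0 := fun i => by
    have e := anticommForm_smul 1 ‖b k‖ (a i) b' v
    have hin : ‖(inner ℂ (a i) (b k) : ℂ)‖ = ‖b k‖ * ‖(inner ℂ (a i) b' : ℂ)‖ := by
      conv_lhs => rw [hbb]
      rw [inner_smul_right, norm_mul, Complex.norm_real, norm_norm]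
    rw [← hbb, Complex.ofReal_one, one_smul] at e
    have h2 := hi i
    rw [overlapGap, e, hin] at h2
    have h3 : ‖b k‖ ^ 2 * overlapGap c (a i) b' v = 0 := by
      rw [overlapGap, hb', ← h2]
      ring
    exact (mul_eq_zero.mp h3).resolve_left (pow_ne_zero 2 (norm_ne_zero_iff.mpr hk))
  choose μ hμ using fun i => eq_smul_of_overlapGap_eq_zero hc hb' hv (hi' i)
  set z := ((1 + c : ℝ) : ℂ) • v - (inner ℂ b' v : ℂ) • b' with hz
  refine ⟨((√(∑ i, ‖μ i‖ ^ 2) : ℝ) : ℂ) • z, ?_⟩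
  rw [ketbra_smul, Complex.norm_real, Real.norm_of_nonneg (Real.sqrt_nonneg _),
    Real.sq_sqrt (Finset.sum_nonneg fun i _ => by positivity)]
  push_cast
  rw [Finset.sum_smul]
  refine Finset.sum_congr rfl fun i _ => ?_
  conv_lhs => rw [hμ i, ketbra_smul]
  push_cast
  rfl

variable {d : ℕ} [NeZero d] {ι κ : Type*} [Fintype ι] [Fintype κ]

theorem POVM.sum_operatorGap {d : ℕ} {ι κ : Type*} [Fintype ι] [Fintype κ]
    (A : POVM (Fin d) ι) (B : POVM (Fin d) κ) (c : ℝ)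
    (v : ι × κ → EuclideanSpace ℂ (Fin d)) (hv : ∀ p, ‖v p‖ = 1) :
    ∑ p, operatorGap c (A.elem p.1) (B.elem p.2) (ketbra (v p)) =
      (2 + c) * d ^ 2 + (2 + c⁻¹) * d -
        ∑ p, (permTrace (A.elem p.1) (B.elem p.2) (ketbra (v p))).re := by
  simp only [operatorGap, Complex.sub_re, trace_ketbra, hv, Finset.sum_sub_distrib]
  congr 1
  rw [← Complex.re_sum, ← Finset.sum_mul, Finset.sum_add_distrib, ← Finset.mul_sum,
    ← Finset.mul_sum, POVM.sum_trace_mul_trace, POVM.sum_trace_mul]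
  norm_cast
  simp

/-- A product measurement attaining the maximal fidelity consists of elements of rank at most one
with constant normalized overlap. -/
theorem exists_ketbra_of_estimationFidelity_eq (A : POVM (Fin d) ι) (B : POVM (Fin d) κ)
    (h : estimationFidelity (A.tensor B) = fidelitySep d) :
    ∃ (a : ι → EuclideanSpace ℂ (Fin d)) (b : κ → EuclideanSpace ℂ (Fin d)),
      (∀ j, A.elem j = ketbra (a j)) ∧ (∀ k, B.elem k = ketbra (b k)) ∧
      ∀ j k, ‖(inner ℂ (a j) (b k) : ℂ)‖ = (√(d : ℝ))⁻¹ * (‖a j‖ * ‖b k‖) := by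
  have hd : (0 : ℝ) < d := by exact_mod_cast Nat.pos_of_ne_zero (NeZero.ne d)
  have hs : 0 < √(d : ℝ) := Real.sqrt_pos.mpr hd
  have hsq : √(d : ℝ) ^ 2 = d := Real.sq_sqrt hd.le
  have hc : 0 < (√(d : ℝ))⁻¹ := inv_pos.mpr hs
  choose v hv hmax using fun p : ι × κ => exists_isMax_permTrace (A.elem p.1) (B.elem p.2)
  rw [estimationFidelity_tensor A B v hv hmax, fidelitySep, div_eq_div_iff (by positivity)
    (by positivity)] at h
  have hsum := POVM.sum_operatorGap A B (√(d : ℝ))⁻¹ v hv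
  -- The value `c = 1 / √d` minimizes `c d² + c⁻¹ d`; there the total bound is `2 d (d + 1 + √d)`,
  -- which is the assumed value.
  have hzero : ∑ p, operatorGap (√(d : ℝ))⁻¹ (A.elem p.1) (B.elem p.2) (ketbra (v p)) = 0 := by
    have h' : ∑ p, (permTrace (A.elem p.1) (B.elem p.2) (ketbra (v p))).re =
        2 * (d + 1 + √(d : ℝ)) * d :=
      mul_right_cancel₀ (b := ((d : ℝ) + 1) * (d + 2)) (by positivity) (by rw [h]; ring)
    rw [hsum, h', inv_inv]
    have e : (√(d : ℝ))⁻¹ * (d : ℝ) = √(d : ℝ) := by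
      rw [inv_mul_eq_div, Real.div_sqrt]
    linear_combination (d : ℝ) * e
  have hgap : ∀ j k, operatorGap (√(d : ℝ))⁻¹ (A.elem j) (B.elem k) (ketbra (v (j, k))) = 0 :=
    fun j k => (Finset.sum_eq_zero_iff_of_nonneg fun p _ => operatorGap_nonneg hc
      (A.posSemidef p.1) (B.posSemidef p.2) (hv p)).mp hzero (j, k) (Finset.mem_univ _)
  obtain ⟨k₀, hk₀⟩ : ∃ k, B.elem k ≠ 0 := by
    by_contra! hM
    have := B.sum_elem
    simp [hM] at this
  obtain ⟨j₀, hj₀⟩ : ∃ j, A.elem j ≠ 0 := by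
    by_contra! hM
    have := A.sum_elem
    simp [hM] at this
  choose a ha using fun j => exists_eq_ketbra_of_operatorGap_eq_zero hc (A.posSemidef j)
    (B.posSemidef k₀) hk₀ (hv (j, k₀)) (hgap j k₀)
  choose b hb using fun k => exists_eq_ketbra_of_operatorGap_eq_zero hc (B.posSemidef k)
    (A.posSemidef j₀) hj₀ (hv (j₀, k)) (by rw [operatorGap_comm]; exact hgap j₀ k)
  refine ⟨a, b, ha, hb, fun j k => ?_⟩
  have hjk := hgap j k
  rw [ha, hb, operatorGap_ketbra _ _ _ (hv _)] at hjk
  exact norm_inner_of_overlapGap_eq_zero hc (hv _) hjk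

/-- A simple POVM of rank-one elements attaining the fidelity `2 / (d + 1)` on two copies is
projective. -/
theorem isRankOneProjective_of_estimationFidelity_eq (A : POVM (Fin d) ι) (hA : A.IsSimple)
    (a : ι → EuclideanSpace ℂ (Fin d)) (ha : ∀ j, A.elem j = ketbra (a j))
    (h : estimationFidelity (A.tensor A) = 2 / ((d : ℝ) + 1)) : A.IsRankOneProjective := by
  have hd : (0 : ℝ) < d := by exact_mod_cast Nat.pos_of_ne_zero (NeZero.ne d)
  rw [estimationFidelity_tensor_ketbra A A a a ha ha, div_eq_div_iff (by positivity)
    (by positivity)] at h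
  have h1 := POVM.sum_trace_mul_trace A A
  have h2 := POVM.sum_trace_mul A A
  simp only [ha, trace_ketbra, trace_ketbra_mul_ketbra] at h1 h2
  norm_cast at h1 h2
  have h3 : ∑ p : ι × ι, (‖a p.1‖ * ‖a p.2‖ + ‖(inner ℂ (a p.1) (a p.2) : ℂ)‖) ^ 2 =
      d ^ 2 + 3 * d :=
    mul_right_cancel₀ (b := (d : ℝ) + 1) (by positivity) (by linear_combination h)
  -- This is `y (x - y) = (x + y)² / 2 - x² / 2 - 3 y² / 2`, whose three sums are known. Each term
  -- is nonnegative by Cauchy–Schwarz.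
  have h4 : ∑ p : ι × ι, ‖(inner ℂ (a p.1) (a p.2) : ℂ)‖ *
      (‖a p.1‖ * ‖a p.2‖ - ‖(inner ℂ (a p.1) (a p.2) : ℂ)‖) = 0 := by
    have e : ∀ p : ι × ι, ‖(inner ℂ (a p.1) (a p.2) : ℂ)‖ *
        (‖a p.1‖ * ‖a p.2‖ - ‖(inner ℂ (a p.1) (a p.2) : ℂ)‖) =
        (1 / 2) * (‖a p.1‖ * ‖a p.2‖ + ‖(inner ℂ (a p.1) (a p.2) : ℂ)‖) ^ 2 -
        (1 / 2) * (‖a p.1‖ ^ 2 * ‖a p.2‖ ^ 2) -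
        (3 / 2) * ‖(inner ℂ (a p.1) (a p.2) : ℂ)‖ ^ 2 := fun p => by ring
    simp only [e, Finset.sum_sub_distrib, ← Finset.mul_sum, h1, h2, h3]
    push_cast
    ring
  have h5 : ∀ i j, ‖(inner ℂ (a i) (a j) : ℂ)‖ = 0 ∨ ‖(inner ℂ (a i) (a j) : ℂ)‖ = ‖a i‖ * ‖a j‖ :=
    fun i j => by
      have := (Finset.sum_eq_zero_iff_of_nonneg fun p _ => mul_nonneg (norm_nonneg _)
        (sub_nonneg.mpr (norm_inner_le_norm (a p.1) (a p.2)))).mp h4 (i, j) (Finset.mem_univ _)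
      exact (mul_eq_zero.mp this).imp id fun h => (sub_eq_zero.mp h).symm
  have hort : ∀ i j, i ≠ j → (inner ℂ (a i) (a j) : ℂ) = 0 := fun i j hij => by
    rcases h5 i j with h0 | h0
    · exact norm_eq_zero.mp h0
    · exfalso
      have hlin := hA i j hij
      have hai : a i ≠ 0 := fun h0 => hlin.ne_zero 0 (by simp [ha, h0, ketbra])
      obtain ⟨r, hr⟩ := (((norm_inner_eq_norm_tfae ℂ (a i) (a j)).out 0 2 :
        ‖(inner ℂ (a i) (a j) : ℂ)‖ = ‖a i‖ * ‖a j‖ ↔ a i = 0 ∨ ∃ r : ℂ, a j = r • a i).mp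
          h0).resolve_left hai
      rw [LinearIndependent.pair_iff] at hlin
      have := (hlin ((‖r‖ ^ 2 : ℝ) : ℂ) (-1) (by rw [ha, ha, hr, ketbra_smul]; simp)).2
      simp at this
  have hmul : ∀ i j, i ≠ j → A.elem i * A.elem j = 0 := fun i j hij => by
    rw [ha, ha, ketbra_mul_ketbra, hort i j hij, zero_smul]
  -- Multiplying `∑ i, A.elem i = 1` by `A.elem j` leaves only the diagonal term.
  have hidem : ∀ j, A.elem j * A.elem j = A.elem j := fun j => by
    have := congrArg (A.elem j * ·) A.sum_elem
    simp only [Finset.mul_sum, mul_one] at this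
    rwa [Finset.sum_eq_single j (fun i _ hi => hmul j i hi.symm) (by simp)] at this
  have hne : ∀ j, A.elem j ≠ 0 := fun j hj => by
    by_cases hs : ∃ i, i ≠ j
    · obtain ⟨i, hi⟩ := hs
      exact (hA i j hi).ne_zero 1 (by simpa using hj)
    -- With a single outcome simplicity is vacuous; the element is nonzero because it equals the
    -- identity.
    · push Not at hs
      have := A.sum_elem
      rw [Finset.sum_eq_zero fun i _ => by rw [hs i, hj]] at this
      exact zero_ne_one this
  refine ⟨fun j => ⟨⟨hidem j, (A.posSemidef j).isHermitian⟩, le_antisymm ?_ ?_⟩, hmul⟩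
  · rw [ha]
    exact rank_vecMulVec_le _ _
  · rw [Nat.one_le_iff_ne_zero, Matrix.rank, Ne, Submodule.finrank_eq_zero, LinearMap.range_eq_bot]
    intro h0
    refine hne j (Matrix.toLin'.injective ?_)
    rw [map_zero, ← h0]
    rfl

/-- Rank one makes every column of `P` a multiple of one vector `u`, with coefficients `c`. Then `P
= P * Pᴴ` equals `‖c‖² |u⟩⟨u|`, and the trace of `P * P = P` gives `‖a‖⁴ = ‖a‖²` for `a = ‖c‖ u`. -/
theorem exists_eq_ketbra_of_isStarProjection {P : Matrix n n ℂ} [DecidableEq n]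
    (hP : IsStarProjection P) (hr : P.rank = 1) :
    ∃ a : EuclideanSpace ℂ n, ‖a‖ = 1 ∧ P = ketbra a := by
  have hP0 : P ≠ 0 := by
    rintro rfl
    simp at hr
  rw [Matrix.rank, finrank_eq_one_iff'] at hr
  obtain ⟨⟨u, hu⟩, -, hspan⟩ := hr
  choose c hc using fun j => hspan ⟨P.mulVecLin (Pi.single j 1), LinearMap.mem_range_self _ _⟩
  have hPuc : P = vecMulVec u c := by
    ext i j
    have := congrFun (congrArg Subtype.val (hc j)) i
    simp at this
    rw [vecMulVec_apply, ← this, mul_comm]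
  have hself : P = P * Pᴴ := by
    conv_lhs => rw [← hP.isIdempotentElem.eq]
    congr 1
    exact hP.isSelfAdjoint.star_eq.symm
  have hc2 : star c ⬝ᵥ c = ((‖WithLp.toLp 2 c‖ ^ 2 : ℝ) : ℂ) := by
    rw [dotProduct_comm, ← trace_ketbra, ketbra, trace_vecMulVec]
  set a : EuclideanSpace ℂ n := ((‖WithLp.toLp 2 c‖ : ℝ) : ℂ) • WithLp.toLp 2 u with ha
  have hPa : P = ketbra a := by
    rw [ha, ketbra_smul, Complex.norm_real, norm_norm, ← hc2, hself, hPuc, conjTranspose_vecMulVec,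
      vecMulVec_mul_vecMulVec, vecMulVec_smul, ketbra, dotProduct_comm]
  refine ⟨a, ?_, hPa⟩
  have htr := congrArg trace hP.isIdempotentElem.eq
  rw [hPa, trace_ketbra_mul_ketbra, trace_ketbra, inner_self_eq_norm_sq_to_K] at htr
  norm_cast at htr
  rw [abs_of_nonneg (by positivity)] at htr
  have ha0 : 0 < ‖a‖ := norm_pos_iff.mpr fun h0 => hP0 (by rw [hPa, h0]; simp [ketbra])
  have h1 : ‖a‖ ^ 2 = 1 := by
    refine mul_right_cancel₀ (b := ‖a‖ ^ 2) (by positivity) ?_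
    rw [one_mul, ← sq, htr]
  nlinarith

variable {d : ℕ} [NeZero d] {ι κ : Type*} [Fintype ι] [Fintype κ]

theorem POVM.IsRankOneProjective.exists_ketbra {d : ℕ} {ι : Type*} [Fintype ι]
    {A : POVM (Fin d) ι} (hA : A.IsRankOneProjective) :
    ∃ a : ι → EuclideanSpace ℂ (Fin d), Orthonormal ℂ a ∧ (∀ j, A.elem j = ketbra (a j)) ∧
      Fintype.card ι = d := by
  choose a ha hAa using fun j => exists_eq_ketbra_of_isStarProjection (hA.1 j).1 (hA.1 j).2
  refine ⟨a, ⟨ha, fun i j hij => ?_⟩, hAa, ?_⟩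
  · have h := congrArg trace (hA.2 i j hij)
    rw [hAa, hAa, trace_ketbra_mul_ketbra, trace_zero] at h
    simpa using h
  · have h := A.sum_trace
    simp only [hAa, trace_ketbra, ha] at h
    simp at h
    exact_mod_cast h

theorem estimationFidelity_tensor_self {A : POVM (Fin d) ι} (hA : A.IsRankOneProjective) :
    estimationFidelity (A.tensor A) = 2 / ((d : ℝ) + 1) := by
  classical
  have hd : (0 : ℝ) < d := by exact_mod_cast Nat.pos_of_ne_zero (NeZero.ne d)
  obtain ⟨a, ha, hAa, hcard⟩ := hA.exists_ketbra
  rw [estimationFidelity_tensor_ketbra A A a a hAa hAa]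
  -- The summand is `1` off the diagonal and `4` on it, so the sum is `d² + 3 d`.
  have h : ∀ p : ι × ι, (‖a p.1‖ * ‖a p.2‖ + ‖(inner ℂ (a p.1) (a p.2) : ℂ)‖) ^ 2 =
      1 + if p.1 = p.2 then 3 else 0 := fun p => by
    rw [ha.1, ha.1, orthonormal_iff_ite.mp ha]
    split_ifs <;> norm_num
  simp only [h, Fintype.sum_prod_type, Finset.sum_add_distrib, Finset.sum_ite_eq, Finset.mem_univ,
    if_true, Finset.sum_const, Finset.card_univ, Fintype.card_prod, hcard, nsmul_eq_mul, mul_one]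
  push_cast
  field_simp
  ring

theorem estimationFidelity_tensor_of_isMutuallyUnbiased {A : POVM (Fin d) ι} {B : POVM (Fin d) κ}
    (hA : A.IsRankOneProjective) (hB : B.IsRankOneProjective) (h : A.IsMutuallyUnbiased B) :
    estimationFidelity (A.tensor B) = fidelitySep d := by
  have hd : (0 : ℝ) < d := by exact_mod_cast Nat.pos_of_ne_zero (NeZero.ne d)
  have hs : 0 < √(d : ℝ) := Real.sqrt_pos.mpr hd
  have hsq : √(d : ℝ) ^ 2 = d := Real.sq_sqrt hd.le
  obtain ⟨a, ha, hAa, hcA⟩ := hA.exists_ketbra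
  obtain ⟨b, hb, hBb, hcB⟩ := hB.exists_ketbra
  rw [estimationFidelity_tensor_ketbra A B a b hAa hBb]
  have hin : ∀ j k, ‖(inner ℂ (a j) (b k) : ℂ)‖ = (√(d : ℝ))⁻¹ := fun j k => by
    have hjk := h j k
    rw [hAa, hBb, trace_ketbra_mul_ketbra, trace_ketbra, trace_ketbra, ha.1, hb.1,
      Fintype.card_fin] at hjk
    have hjk' : ‖(inner ℂ (a j) (b k) : ℂ)‖ ^ 2 = (d : ℝ)⁻¹ := by
      apply Complex.ofReal_injective
      rw [hjk]
      push_cast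
      ring
    rw [← Real.sqrt_inv, ← hjk', Real.sqrt_sq (norm_nonneg _)]
  simp only [ha.1, hb.1, hin, Finset.sum_const, Finset.card_univ, Fintype.card_prod, hcA, hcB,
    nsmul_eq_mul]
  rw [fidelitySep]
  push_cast
  have e : (d : ℝ) * (d : ℝ) * (1 * 1 + (√(d : ℝ))⁻¹) ^ 2 = (d : ℝ) * (√(d : ℝ) + 1) ^ 2 := by
    field_simp
    rw [hsq]
  rw [e, div_eq_div_iff (by positivity) (by positivity)]
  linear_combination (d : ℝ) * ((d : ℝ) + 1) * (d + 2) * hsq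

theorem isMutuallyUnbiased_of_norm_inner {d : ℕ} {ι κ : Type*} [Fintype ι] [Fintype κ]
    {A : POVM (Fin d) ι} {B : POVM (Fin d) κ}
    {a : ι → EuclideanSpace ℂ (Fin d)} {b : κ → EuclideanSpace ℂ (Fin d)}
    (ha : ∀ j, A.elem j = ketbra (a j)) (hb : ∀ k, B.elem k = ketbra (b k))
    (h : ∀ j k, ‖(inner ℂ (a j) (b k) : ℂ)‖ = (√(d : ℝ))⁻¹ * (‖a j‖ * ‖b k‖)) :
    A.IsMutuallyUnbiased B := fun j k => by
  have hsq : √(d : ℝ) ^ 2 = d := Real.sq_sqrt (Nat.cast_nonneg d)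
  rw [ha, hb, trace_ketbra_mul_ketbra, trace_ketbra, trace_ketbra, h, mul_pow, inv_pow, hsq,
    Fintype.card_fin]
  push_cast
  ring

end Saturation

end

theorem corollary8 (d : ℕ) [NeZero d] {ι κ : Type*} [Fintype ι] [Fintype κ]
    (A : POVM (Fin d) ι) (B : POVM (Fin d) κ) (hA : A.IsSimple) (hB : B.IsSimple) :
    (A.IsRankOneProjective ∧ B.IsRankOneProjective ∧ A.IsMutuallyUnbiased B) ↔
      (estimationFidelity (A.tensor B) = fidelitySep d ∧
        estimationFidelity (A.tensor A) = 2 / ((d : ℝ) + 1) ∧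
        estimationFidelity (B.tensor B) = 2 / ((d : ℝ) + 1)) := by
  constructor
  · rintro ⟨h1, h2, h3⟩
    exact ⟨estimationFidelity_tensor_of_isMutuallyUnbiased h1 h2 h3,
      estimationFidelity_tensor_self h1, estimationFidelity_tensor_self h2⟩
  · rintro ⟨h1, h2, h3⟩
    obtain ⟨a, b, ha, hb, hab⟩ := exists_ketbra_of_estimationFidelity_eq A B h1
    exact ⟨isRankOneProjective_of_estimationFidelity_eq A hA a ha h2,
      isRankOneProjective_of_estimationFidelity_eq B hB b hb h3,
      isMutuallyUnbiased_of_norm_inner ha hb hab⟩
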